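/- Let $\mathcal C$ be a SAT instance with variables $V_1,\dots,V_n$ and clauses $C_1,\dots,C_m$, where $C_j=\{L_{j,1},\dots,L_{j,n_j}\}$ and each $L_{j,t}$ is a variable or a negated variable. (The case $n_j=0$ is allowed.) The directed graph $G_{\mathcal C}$ and the vertex disjoint paths instance $\mathcal P_{\mathcal C}$ on it are defined as follows. *Routing gadget.* It has the vertices $s_1,\dots,s_4,t_1,\dots,t_4,d_1,\dots,d_9$, the edges $s_1\to d_1,d_3$; $s_2\to d_3,d_4$; $s_3\to d_6,d_7$; $s_4\to d_2,d_7$; $d_1\to d_4,d_5$; $d_2\to d_5,d_6$; $d_3\to t_1,t_2$; $d_4\to t_1,d_8$; $d_5\to d_8,d_9$; $d_6\to d_9,t_4$; $d_7\to t_4,t_3$; $d_8\to t_2$; $d_9\to t_3$, and the source/target pairs $(s_k,t_k)$, $1\le k\le 4$. An edge into the gadget from the top (left) ends in $d_1$ ($d_2$); an edge out of the gadget to the right (bottom) starts in $d_8$ ($d_9$). *Crossing gadget.* It has the vertices $H^{in},L^{in},H^{out},L^{out},T,B,X,Y,Z,W,m_0,\dots,m_{12}$ and six copies $b_1,\dots,b_6$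 of the routing gadget. Writing $b^{\mathrm t},b^{\mathrm l},b^{\mathrm r},b^{\mathrm b}$ for the vertices $d_1,d_2,d_8,d_9$ of the copy $b$, its edges, besides those inside the copies, are $e^+=(m_1,b_4^{\mathrm t})$, $e^-=(m_1,b_1^{\mathrm t})$ and $H^{in}\to b_1^{\mathrm l}$; $L^{in}\to m_3$; $T\to m_1$; $b_1^{\mathrm r}\to m_2$; $b_1^{\mathrm b}\to b_2^{\mathrm l}$; $m_2\to m_4$; $X\to m_2,b_2^{\mathrm t}$; $b_2^{\mathrm b}\to m_3$; $b_2^{\mathrm r}\to b_3^{\mathrm l}$; $m_3\to m_5$; $m_4\to b_3^{\mathrm t},b_4^{\mathrm l}$; $b_3^{\mathrm b}\to W$; $b_3^{\mathrm r}\to m_0$; $m_5\to W,m_6$; $b_4^{\mathrm b}\to m_0$; $b_4^{\mathrm r}\to m_7$; $m_0\to m_6,b_5^{\mathrm l}$; $m_6\to m_8,m_{12}$; $m_7\to m_9$; $Z\to m_7,b_5^{\mathrm t}$; $b_5^{\mathrm r}\to b_6^{\mathrm l}$; $b_5^{\mathrm b}\to m_8$; $m_8\to m_{10}$; $m_9\to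 H^{out},b_6^{\mathrm t}$; $b_6^{\mathrm r}\to m_{11}$; $b_6^{\mathrm b}\to Y$; $m_{10}\to Y,m_{11}$; $m_{11}\to m_{12},L^{out}$; $m_{12}\to B$. *The graph $G_{\mathcal C}$.* Order the columns $(j,t)$, $1\le j\le m$, $1\le t\le n_j$, lexicographically. The vertices are $V_i,V_i'$ for $1\le i\le n$, $C_j,C_j'$ for $1\le j\le m$, and those of a crossing gadget $G_{i,c}$ for each $i$ and each column $c$; the vertices of $G_{i,c}$ carry the subscript $i,c$. In $G_{i,(j,t)}$ the edge $e^-$ is deleted if $L_{j,t}=V_i$, and the edge $e^+$ is deleted if $L_{j,t}=\neg V_i$. The further edges are: $V_i\to H^{in}_{i,c},L^{in}_{i,c}$ for the first column $c$; $H^{out}_{i,c}\to H^{in}_{i,c'}$ and $L^{out}_{i,c}\to L^{in}_{i,c'}$ whenever $c'$ is the column following $c$; $H^{out}_{i,c},L^{out}_{i,c}\to V_i'$ for the last column $c$; $B_{i,c}\to T_{i+1,c}$ for $i<n$; and $C_j\to T_{1,(j,t)}$ and $B_{n,(j,t)}\to C_j'$ for all $j,t$ (if $n\geq 1$). *The instance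 $\mathcal P_{\mathcal C}$.* The source/target pairs are all pairs of all routing gadgets, $(X_{i,c},Y_{i,c})$ for all $i$ and $c$, $(V_i,W_{i,c})$ for the first column $c$, $(Z_{i,c},W_{i,c'})$ whenever $c'$ is the column following $c$, $(Z_{i,c},V_i')$ for the last column $c$, and $(C_j,C_j')$ for all $j$. A solution links each source to its target by a directed path such that the paths are pairwise vertex disjoint. **Theorem.** $\mathcal C$ is satisfiable if and only if $\mathcal P_{\mathcal C}$ has a solution. -/

import Mathlib

namespace SatVDP

/-! ### The vertex disjoint paths problem on digraphs -/

/-- `p`, the list of the vertices in the order in which they are visited, is a directed (simple)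
path of `G` from `s` to `t`. -/
structure IsDirectedPath {V : Type} (G : Digraph V) (s t : V) (p : List V) : Prop where
  head_eq : p.head? = some s
  last_eq : p.getLast? = some t
  chain : p.IsChain G.Adj
  nodup : p.Nodup

/-- An instance of the vertex disjoint paths problem: a digraph with a set of source/target
pairs. -/
structure VDPInstance (V : Type) where
  /-- the digraph -/
  graph : Digraph V
  /-- the set of the source/target pairs `(s, t)` -/
  pairs : Set (V × V)

/-- The instance has a solution: the pairs can be linked by directed paths no two of which have
a vertex in common. -/
def VDPInstance.HasSolution {V : Type} (P : VDPInstance V) : Prop :=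
  ∃ path : V × V → List V,
    (∀ q ∈ P.pairs, IsDirectedPath P.graph q.1 q.2 (path q)) ∧
    (∀ q ∈ P.pairs, ∀ q' ∈ P.pairs, q ≠ q' → List.Disjoint (path q) (path q'))

/-! ### SAT instances -/

/-- Literals over the variables `V_i`, `i : Fin n`. -/
inductive Literal (n : ℕ) where
  /-- the variable `V_i` -/
  | pos (i : Fin n)
  /-- the negated variable `¬ V_i` -/
  | neg (i : Fin n)
  deriving DecidableEq

/-- The literal is true under the assignment `β`. -/
def Literal.IsTrue {n : ℕ} (β : Fin n → Bool) : Literal n → Prop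
  | .pos i => β i = true
  | .neg i => β i = false

/-- A SAT instance with `n` variables and `m` clauses, the `j`-th of which consists of the
literals `lit j t`, `t : Fin (size j)`. Clauses may be empty. -/
structure SATInstance where
  /-- the number of variables -/
  n : ℕ
  /-- the number of clauses -/
  m : ℕ
  /-- the number of literals of each clause -/
  size : Fin m → ℕ
  /-- the literals of each clause -/
  lit : (j : Fin m) → Fin (size j) → Literal n

/-- Some assignment makes at least one literal of every clause true. -/
def SATInstance.Satisfiable (C : SATInstance) : Prop :=
  ∃ β : Fin C.n → Bool, ∀ j : Fin C.m, ∃ t : Fin (C.size j), (C.lit j t).IsTrue β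

/-! ### The routing gadget -/

/-- The vertices of the routing gadget: the sources `1, …, 4`, their targets `1', …, 4'` and nine
further vertices. The connections of the gadget to the outside are the edge from the top, which
enters at `d1`, the edge from the left, which enters at `d2`, the edge to the right, which leaves
from `d8`, and the edge to the bottom, which leaves from `d9`. -/
inductive RoutingVertex where
  | s1 | s2 | s3 | s4
  | t1 | t2 | t3 | t4
  | d1 | d2 | d3 | d4 | d5 | d6 | d7 | d8 | d9
  deriving DecidableEq

open RoutingVertex in
/-- The edges inside the routing gadget. -/
def routingEdges : List (RoutingVertex × RoutingVertex) :=
  [(s1, d1), (s1, d3), (s2, d3), (s2, d4), (s3, d6), (s3, d7), (s4, d2), (s4, d7),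
   (d1, d4), (d1, d5), (d2, d5), (d2, d6),
   (d3, t1), (d3, t2), (d4, t1), (d4, d8), (d5, d8), (d5, d9), (d6, d9), (d6, t4),
   (d7, t4), (d7, t3), (d8, t2), (d9, t3)]

open RoutingVertex in
/-- The source/target pairs of the routing gadget. -/
def routingPairs : List (RoutingVertex × RoutingVertex) :=
  [(s1, t1), (s2, t2), (s3, t3), (s4, t4)]

/-! ### The crossing gadget -/

/-- The names of the six routing gadgets inside a crossing gadget. -/
inductive Box where
  | b1 | b2 | b3 | b4 | b5 | b6
  deriving DecidableEq

/-- The vertices of the crossing gadget. -/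
inductive CrossingVertex where
  | Hin | Lin | Hout | Lout | T | B | X | Y | Z | W
  | m0 | m1 | m2 | m3 | m4 | m5 | m6 | m7 | m8 | m9 | m10 | m11 | m12
  /-- the copy of the vertex `v` in the routing gadget `b` -/
  | box (b : Box) (v : RoutingVertex)
  deriving DecidableEq

/-- Where the edge from the top enters the routing gadget `b`. -/
abbrev Box.top (b : Box) : CrossingVertex := .box b .d1

/-- Where the edge from the left enters the routing gadget `b`. -/
abbrev Box.left (b : Box) : CrossingVertex := .box b .d2

/-- Where the edge to the right leaves the routing gadget `b`. -/
abbrev Box.right (b : Box) : CrossingVertex := .box b .d8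

/-- Where the edge to the bottom leaves the routing gadget `b`. -/
abbrev Box.bottom (b : Box) : CrossingVertex := .box b .d9

open CrossingVertex Box in
/-- The edge `e⁺` of the crossing gadget. -/
def ePlus : CrossingVertex × CrossingVertex := (m1, b4.top)

open CrossingVertex Box in
/-- The edge `e⁻` of the crossing gadget. -/
def eMinus : CrossingVertex × CrossingVertex := (m1, b1.top)

open CrossingVertex Box in
/-- The edges of the crossing gadget other than `e⁺`, `e⁻` and those inside the six routing
gadgets. -/
def crossingEdges : List (CrossingVertex × CrossingVertex) :=
  [(Hin, b1.left), (Lin, m3), (T, m1), (b1.right, m2), (b1.bottom, b2.left),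
   (m2, m4), (X, m2), (X, b2.top), (b2.bottom, m3), (b2.right, b3.left), (m3, m5),
   (m4, b3.top), (m4, b4.left), (b3.bottom, W), (b3.right, m0), (m5, W), (m5, m6),
   (b4.bottom, m0), (b4.right, m7), (m0, m6), (m0, b5.left), (m6, m8), (m6, m12),
   (m7, m9), (Z, m7), (Z, b5.top), (b5.right, b6.left), (b5.bottom, m8), (m8, m10),
   (m9, Hout), (m9, b6.top), (b6.right, m11), (b6.bottom, Y), (m10, Y), (m10, m11),
   (m11, m12), (m11, Lout), (m12, B)]

/-- Adjacency in the full crossing gadget. -/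
inductive CrossingAdj : CrossingVertex → CrossingVertex → Prop
  | plus : CrossingAdj ePlus.1 ePlus.2
  | minus : CrossingAdj eMinus.1 eMinus.2
  | outer {u v : CrossingVertex} (h : (u, v) ∈ crossingEdges) : CrossingAdj u v
  | inner (b : Box) {u v : RoutingVertex} (h : (u, v) ∈ routingEdges) :
      CrossingAdj (.box b u) (.box b v)

/-! ### The vertex disjoint paths instance of a SAT instance -/

namespace SATInstance

variable (C : SATInstance)

/-- The columns: pairs `(j, t)` of a clause and (the position of) one of its literals, in the
lexicographic order, which is the order in which the columns are drawn from left to right. -/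
abbrev Column : Type := Σₗ j : Fin C.m, Fin (C.size j)

/-- The literal `lit j t` that belongs to the column `(j, t)`. -/
def columnLit (c : C.Column) : Literal C.n := C.lit (ofLex c).1 (ofLex c).2

/-- The vertices of the graph of `C`. -/
inductive Vertex where
  /-- the vertex `V_i` -/
  | var (i : Fin C.n)
  /-- the vertex `V'_i` -/
  | var' (i : Fin C.n)
  /-- the vertex `C_j` -/
  | clause (j : Fin C.m)
  /-- the vertex `C'_j` -/
  | clause' (j : Fin C.m)
  /-- the copy of the vertex `v` in the crossing gadget in row `i` and column `c` -/
  | gadget (i : Fin C.n) (c : C.Column) (v : CrossingVertex)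

open Vertex in
/-- Adjacency in the graph of `C`. Here `IsMin c` and `IsMax c` say that `c` is the first and the
last column, and `c ⋖ c'` says that `c'` is the column immediately to the right of `c`. -/
inductive Adj : C.Vertex → C.Vertex → Prop
  /-- the edges of the crossing gadgets; `e⁺` is deleted if the literal of the column is the
  negation of the variable of the row, `e⁻` if it is the variable of the row -/
  | inside (i : Fin C.n) (c : C.Column) {u v : CrossingVertex} (h : CrossingAdj u v)
      (hplus : (u, v) = ePlus → C.columnLit c ≠ .neg i)
      (hminus : (u, v) = eMinus → C.columnLit c ≠ .pos i) :
      Adj (gadget i c u) (gadget i c v)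
  | rowStartH (i : Fin C.n) (c : C.Column) (hc : IsMin c) : Adj (var i) (gadget i c .Hin)
  | rowStartL (i : Fin C.n) (c : C.Column) (hc : IsMin c) : Adj (var i) (gadget i c .Lin)
  | rowNextH (i : Fin C.n) (c c' : C.Column) (hc : c ⋖ c') :
      Adj (gadget i c .Hout) (gadget i c' .Hin)
  | rowNextL (i : Fin C.n) (c c' : C.Column) (hc : c ⋖ c') :
      Adj (gadget i c .Lout) (gadget i c' .Lin)
  | rowEndH (i : Fin C.n) (c : C.Column) (hc : IsMax c) : Adj (gadget i c .Hout) (var' i)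
  | rowEndL (i : Fin C.n) (c : C.Column) (hc : IsMax c) : Adj (gadget i c .Lout) (var' i)
  | colStart (i : Fin C.n) (j : Fin C.m) (t : Fin (C.size j)) (hi : (i : ℕ) = 0) :
      Adj (clause j) (gadget i (toLex ⟨j, t⟩) .T)
  | colNext (i i' : Fin C.n) (c : C.Column) (hi : (i' : ℕ) = i + 1) :
      Adj (gadget i c .B) (gadget i' c .T)
  | colEnd (i : Fin C.n) (j : Fin C.m) (t : Fin (C.size j)) (hi : (i : ℕ) + 1 = C.n) :
      Adj (gadget i (toLex ⟨j, t⟩) .B) (clause' j)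

open Vertex in
/-- The source/target pairs. -/
inductive IsPair : C.Vertex → C.Vertex → Prop
  | routing (i : Fin C.n) (c : C.Column) (b : Box) {u v : RoutingVertex}
      (h : (u, v) ∈ routingPairs) : IsPair (gadget i c (.box b u)) (gadget i c (.box b v))
  | varStart (i : Fin C.n) (c : C.Column) (hc : IsMin c) : IsPair (var i) (gadget i c .W)
  | varNext (i : Fin C.n) (c c' : C.Column) (hc : c ⋖ c') :
      IsPair (gadget i c .Z) (gadget i c' .W)
  | varEnd (i : Fin C.n) (c : C.Column) (hc : IsMax c) : IsPair (gadget i c .Z) (var' i)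
  | cross (i : Fin C.n) (c : C.Column) : IsPair (gadget i c .X) (gadget i c .Y)
  | clausePair (j : Fin C.m) : IsPair (clause j) (clause' j)

/-- The graph of `C`. -/
def graph : Digraph C.Vertex where
  Adj := C.Adj

/-- The vertex disjoint paths instance of `C`. -/
def vdp : VDPInstance C.Vertex where
  graph := C.graph
  pairs := {q | C.IsPair q.1 q.2}

end SATInstance

end SatVDP

namespace SatVDP

/-! ### Directed paths -/

/-! A routing gadget acts as a switch. Its own four pairs block so many vertices that an outside
path entering at the top must leave at the bottom, and one entering from the left must leave to the
right; the two passages exclude each other (`vertical`, `horizontal`,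
`not_vertical_and_horizontal`).

In a crossing gadget the path to `W` arrives at `Hin` or at `Lin`, and this choice forces the rest
by disjointness and acyclicity (`high_routing`, `low_routing`). The path from `Z` leaves at `Hout`
or `Lout` respectively, so the choice is the same along the whole row and serves as the truth value
of the variable. The path of a clause entering at `T` must use `e⁺` in a high row and `e⁻` in a low
one, and it leaves at `B`. It therefore descends through all rows of one column, and in the row of
that column's literal the deleted edge rules out the value that makes the literal false.

Conversely, an assignment prescribes one of two routings in every gadget. Each vertex is labelled
with the target of the route it belongs to (`targetOf`). A walk inside one label class meets no walk
of another class, and a target determines its source, so the walks of distinct pairs are disjoint; a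
rank increasing along the edges makes them simple. -/

theorem IsDirectedPath.exists_next {V : Type} {G : Digraph V} {s t v : V} {p : List V}
    (h : IsDirectedPath G s t p) (hv : v ∈ p) (hne : v ≠ t) : ∃ w ∈ p, G.Adj v w := by
  obtain ⟨l₁, l₂, rfl⟩ := List.append_of_mem hv
  cases l₂ with
  | nil => exact absurd (by simpa using h.last_eq) hne
  | cons w l =>
    have := (List.isChain_append.1 h.chain).2.1
    exact ⟨w, by simp, (List.isChain_cons_cons.1 this).1⟩

theorem IsDirectedPath.source_mem {V : Type} {G : Digraph V} {s t : V} {p : List V}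
    (h : IsDirectedPath G s t p) : s ∈ p :=
  List.mem_of_mem_head? h.head_eq

theorem IsDirectedPath.target_mem {V : Type} {G : Digraph V} {s t : V} {p : List V}
    (h : IsDirectedPath G s t p) : t ∈ p :=
  List.mem_of_mem_getLast? h.last_eq

/-- Along a directed path every vertex is at most the target, for any rank that increases along
the edges. -/
theorem IsDirectedPath.rank_le {V R : Type} [Preorder R] {G : Digraph V} {r : V → R}
    (hr : ∀ u v, G.Adj u v → r u < r v) {s t v : V} {p : List V}
    (h : IsDirectedPath G s t p) (hv : v ∈ p) : r v ≤ r t := by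
  obtain ⟨l₁, l₂, rfl⟩ := List.append_of_mem hv
  have hc := (List.isChain_append.1 h.chain).2.1
  have hlast : (v :: l₂).getLast? = some t := by simpa using h.last_eq
  clear h hv
  induction l₂ generalizing v with
  | nil => simp at hlast; rw [hlast]
  | cons w l ih =>
    rw [List.isChain_cons_cons] at hc
    exact (hr _ _ hc.1).le.trans (ih hc.2 (by simpa using hlast))

/-! ### Depth functions: the graph is acyclic -/

/-- A depth that increases along the edges of the routing gadget. -/
def RoutingVertex.depth : RoutingVertex → ℕ
  | s1 | s2 | s3 | s4 => 0
  | d1 | d2 | d3 | d7 => 1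
  | d4 | d5 | d6 => 2
  | d8 | d9 => 3
  | t1 | t2 | t3 | t4 => 4

/-- The position of a routing gadget in a topological order of the crossing gadget. -/
def Box.level : Box → ℕ
  | b1 => 2 | b2 => 3 | b3 => 6 | b4 => 11 | b5 => 15 | b6 => 18

/-- A depth that increases along the edges of the crossing gadget. -/
def CrossingVertex.depth : CrossingVertex → ℕ
  | Hin | Lin | T | X => 0
  | m1 => 5 | m2 => 20 | m4 => 25 | m3 => 35 | m5 => 40 | W => 45 | Z => 50 | m0 => 60
  | m6 => 65 | m7 => 70 | m8 => 80 | m9 => 85 | m10 => 95 | Y => 100 | Hout => 105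
  | m11 => 110 | m12 => 115 | Lout => 120 | B => 125
  -- Depths inside a routing gadget are 0 to 4, so each box fills one block of five. The order puts
  -- `b4` after `W` and `m12` after `Y`, which `high_routing` uses to discard branches.
  | box b v => 5 * b.level + v.depth

theorem routing_depth_lt : ∀ e ∈ routingEdges, e.1.depth < e.2.depth := by decide

theorem crossingEdges_depth_lt : ∀ e ∈ crossingEdges, e.1.depth < e.2.depth := by decide

theorem CrossingAdj.depth_lt {u v : CrossingVertex} (h : CrossingAdj u v) :
    u.depth < v.depth := by
  cases h with
  | plus => decide
  | minus => decide
  | outer h => exact crossingEdges_depth_lt _ h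
  | inner b h => exact Nat.add_lt_add_left (routing_depth_lt _ h) _

namespace SATInstance

variable {C : SATInstance}

/-- A rank that increases along the edges of the graph of `C`: row, column, depth. -/
def rank : C.Vertex → ℕ ×ₗ (WithBot (WithTop C.Column) ×ₗ ℕ)
  | .var i => toLex ((i : ℕ), toLex (⊥, 0))
  | .var' i => toLex ((i : ℕ), toLex (((⊤ : WithTop C.Column) : WithBot (WithTop C.Column)), 0))
  | .clause _ => toLex (0, toLex (⊥, 0))
  | .clause' _ => toLex (C.n, toLex (⊥, 0))
  | .gadget i c v =>
    toLex ((i : ℕ), toLex (((c : WithTop C.Column) : WithBot (WithTop C.Column)), v.depth))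

theorem rank_lt_of_adj (u v : C.Vertex) (h : C.graph.Adj u v) : rank u < rank v := by
  change C.Adj u v at h
  cases h with
  | inside i c h => simpa [rank, Prod.Lex.toLex_lt_toLex] using h.depth_lt
  | rowStartH i c hc => simp [rank, Prod.Lex.toLex_lt_toLex]
  | rowStartL i c hc => simp [rank, Prod.Lex.toLex_lt_toLex]
  | rowNextH i c c' hc => simp [rank, Prod.Lex.toLex_lt_toLex, hc.lt]
  | rowNextL i c c' hc => simp [rank, Prod.Lex.toLex_lt_toLex, hc.lt]
  | rowEndH i c hc =>
    simpa [rank, Prod.Lex.toLex_lt_toLex] using WithBot.coe_lt_coe.2 (WithTop.coe_lt_top c)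
  | rowEndL i c hc =>
    simpa [rank, Prod.Lex.toLex_lt_toLex] using WithBot.coe_lt_coe.2 (WithTop.coe_lt_top c)
  | colStart i j t hi => simp [rank, Prod.Lex.toLex_lt_toLex, hi]
  | colNext i i' c hi => simp [rank, Prod.Lex.toLex_lt_toLex, hi]
  | colEnd i j t hi => simp [rank, Prod.Lex.toLex_lt_toLex, ← hi]

end SATInstance

/-! ### Successors inside the gadgets -/

/-- The successors inside the routing gadget. -/
def RoutingVertex.next (u : RoutingVertex) : List RoutingVertex :=
  (routingEdges.filter (·.1 = u)).map (·.2)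

/-- The successors in the crossing gadget along the edges that are not inside a routing gadget. -/
def CrossingVertex.outerNext (u : CrossingVertex) : List CrossingVertex :=
  ((ePlus :: eMinus :: crossingEdges).filter (·.1 = u)).map (·.2)

/-- The successors in the crossing gadget. -/
def CrossingVertex.next : CrossingVertex → List CrossingVertex
  | box b u => u.next.map (box b) ++ outerNext (box b u)
  | u => outerNext u

theorem CrossingVertex.outerNext_subset (u : CrossingVertex) : u.outerNext ⊆ u.next := by
  cases u <;> simp [next]

theorem CrossingAdj.mem_next {u v : CrossingVertex} (h : CrossingAdj u v) : v ∈ u.next := by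
  cases h with
  | plus => exact CrossingVertex.outerNext_subset _ (by decide)
  | minus => exact CrossingVertex.outerNext_subset _ (by decide)
  | outer h =>
    refine CrossingVertex.outerNext_subset _ (List.mem_map.2 ⟨(u, v), ?_, rfl⟩)
    simp [h]
  | @inner b u v h =>
    refine List.mem_append_left _ (List.mem_map.2 ⟨v, List.mem_map.2 ⟨(u, v), ?_, rfl⟩, rfl⟩)
    simp [h]

/-- The vertices of the routing gadget that are no targets. -/
def RoutingVertex.transit : RoutingVertex → Bool
  | t1 | t2 | t3 | t4 => false
  | _ => true

/-- The vertices of the crossing gadget that are no targets and have no edges to the outside. -/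
def CrossingVertex.transit : CrossingVertex → Bool
  | Hout | Lout | B | W | Y => false
  | box _ v => v.transit
  | _ => true

/-- Where the bottom edge of a routing gadget leads to. -/
def Box.bottomExit : Box → CrossingVertex
  | b1 => b2.left | b2 => .m3 | b3 => .W | b4 => .m0 | b5 => .m8 | b6 => .Y

/-- Where the right edge of a routing gadget leads to. -/
def Box.rightExit : Box → CrossingVertex
  | b1 => .m2 | b2 => b3.left | b3 => .m0 | b4 => .m7 | b5 => b6.left | b6 => .m11

/-! ### Paths of a solution -/

namespace SATInstance

variable {C : SATInstance}

/-- The paths form a solution of the instance of `C`. -/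
structure IsSolution (C : SATInstance) (path : C.Vertex × C.Vertex → List C.Vertex) : Prop where
  isPath : ∀ q ∈ C.vdp.pairs, IsDirectedPath C.vdp.graph q.1 q.2 (path q)
  disjoint : ∀ q ∈ C.vdp.pairs, ∀ q' ∈ C.vdp.pairs, q ≠ q' → List.Disjoint (path q) (path q')

/-- The pair is not one of a routing gadget. -/
def External (q : C.Vertex × C.Vertex) : Prop :=
  C.IsPair q.1 q.2 ∧ ∀ i c b v, q.2 ≠ .gadget i c (.box b v)

theorem IsPair.target_not_transit {s : C.Vertex} {i : Fin C.n} {c : C.Column}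
    {u : CrossingVertex} (h : C.IsPair s (.gadget i c u)) : u.transit = false := by
  cases h with
  | @routing _ _ b s t h =>
    simp only [routingPairs, List.mem_cons, Prod.mk.injEq, List.not_mem_nil, or_false] at h
    rcases h with ⟨-, rfl⟩ | ⟨-, rfl⟩ | ⟨-, rfl⟩ | ⟨-, rfl⟩ <;> rfl
  | _ => rfl

namespace IsSolution

variable {path : C.Vertex × C.Vertex → List C.Vertex} (S : C.IsSolution path)
include S

theorem eq_of_mem {q q' : C.Vertex × C.Vertex} {v : C.Vertex} (hq : C.IsPair q.1 q.2)
    (hq' : C.IsPair q'.1 q'.2) (h : v ∈ path q) (h' : v ∈ path q') : q = q' := by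
  by_contra hne
  exact S.disjoint q hq q' hq' hne h h'

theorem source_mem {q : C.Vertex × C.Vertex} (hq : C.IsPair q.1 q.2) : q.1 ∈ path q :=
  (S.isPath q hq).source_mem

theorem target_mem {q : C.Vertex × C.Vertex} (hq : C.IsPair q.1 q.2) : q.2 ∈ path q :=
  (S.isPath q hq).target_mem

theorem rank_le {q : C.Vertex × C.Vertex} {v : C.Vertex} (hq : C.IsPair q.1 q.2)
    (h : v ∈ path q) : rank v ≤ rank q.2 :=
  (S.isPath q hq).rank_le rank_lt_of_adj h

theorem exists_adj {q : C.Vertex × C.Vertex} {v : C.Vertex} (hq : C.IsPair q.1 q.2)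
    (h : v ∈ path q) (hne : v ≠ q.2) : ∃ w ∈ path q, C.Adj v w :=
  (S.isPath q hq).exists_next h hne

/-- At a transit vertex a path can neither stop nor leave the gadget. The list `next` ignores the
deletion of `e⁺` and `e⁻`; the adjacency is returned as well so that at `m1` the deletion can be
taken into account. -/
theorem exists_next {q : C.Vertex × C.Vertex} {i : Fin C.n} {c : C.Column} {u : CrossingVertex}
    (hq : C.IsPair q.1 q.2) (hu : u.transit = true) (h : .gadget i c u ∈ path q) :
    ∃ u' ∈ u.next, .gadget i c u' ∈ path q ∧ C.Adj (.gadget i c u) (.gadget i c u') := by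
  have hne : .gadget i c u ≠ q.2 := by
    intro he
    rw [← he] at hq
    simp [hq.target_not_transit] at hu
  obtain ⟨w, hw, hadj⟩ := S.exists_adj hq h hne
  cases hadj with
  | inside _ _ hc hp hm => exact ⟨_, hc.mem_next, hw, .inside i c hc hp hm⟩
  | _ => simp [CrossingVertex.transit] at hu

end IsSolution
end SATInstance
end SatVDP
-- Pairs outside the routing gadgets; induction along a row
namespace SatVDP
namespace SATInstance
variable {C : SATInstance}

/-- The pair `(X, Y)` of a crossing gadget. -/
def crossPair (i : Fin C.n) (c : C.Column) : C.Vertex × C.Vertex := (.gadget i c .X, .gadget i c .Y)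

theorem external_crossPair (i : Fin C.n) (c : C.Column) : External (crossPair i c) :=
  ⟨.cross i c, by simp [crossPair]⟩

theorem external_of_target_W {q : C.Vertex × C.Vertex} {i : Fin C.n} {c : C.Column}
    (hq : C.IsPair q.1 q.2) (h : q.2 = .gadget i c .W) : External q :=
  ⟨hq, by simp [h]⟩

theorem external_of_source_Z {q : C.Vertex × C.Vertex} {i : Fin C.n} {c : C.Column}
    (hq : C.IsPair q.1 q.2) (h : q.1 = .gadget i c .Z) :
    External q ∧ ((∃ c', c ⋖ c' ∧ q.2 = .gadget i c' .W) ∨ IsMax c ∧ q.2 = .var' i) := by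
  obtain ⟨s, t⟩ := q
  simp only at hq h
  subst h
  refine ⟨⟨hq, ?_⟩, ?_⟩
  · cases hq <;> simp
  · cases hq with
    | varNext _ _ c' hc => exact .inl ⟨c', hc, rfl⟩
    | varEnd _ _ hc => exact .inr ⟨hc, rfl⟩

theorem external_clause (j : Fin C.m) :
    External ((.clause j, .clause' j) : C.Vertex × C.Vertex) :=
  ⟨.clausePair j, by simp⟩

theorem exists_pair_of_Z (i : Fin C.n) (c : C.Column) :
    ∃ q : C.Vertex × C.Vertex, C.IsPair q.1 q.2 ∧ q.1 = .gadget i c .Z := by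
  by_cases hc : IsMax c
  · exact ⟨(.gadget i c .Z, .var' i), .varEnd i c hc, rfl⟩
  · obtain ⟨c', hc'⟩ := exists_covBy_of_wellFoundedLT hc
    exact ⟨(.gadget i c .Z, .gadget i c' .W), .varNext i c c' hc', rfl⟩

theorem column_induction {P : C.Column → Prop} {c₀ : C.Column}
    (hc₀ : IsMin c₀) (h₀ : P c₀) (step : ∀ c c', c ⋖ c' → P c → P c') (c : C.Column) : P c := by
  induction c using WellFoundedLT.induction with
  | ind c ih =>
    by_cases hc : IsMin c
    · rwa [← hc.eq_of_le (not_lt.1 hc₀.not_lt)]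
    · obtain ⟨b, hb⟩ := exists_covBy_of_wellFoundedGT hc
      exact step b c hb (ih b hb.lt)

namespace IsSolution

variable {path : C.Vertex × C.Vertex → List C.Vertex} (S : C.IsSolution path)
include S

theorem next_one {q : C.Vertex × C.Vertex} {i : Fin C.n} {c : C.Column} {u : CrossingVertex}
    (a : CrossingVertex) (hq : C.IsPair q.1 q.2) (h : .gadget i c u ∈ path q)
    (hu : u.transit = true := by rfl) (ha : u.next = [a] := by rfl) :
    .gadget i c a ∈ path q := by
  obtain ⟨u', hu', hm, -⟩ := S.exists_next hq hu h
  rw [ha, List.mem_singleton] at hu'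
  rwa [← hu']

/-- The basic forcing move: at a branching, one alternative is refuted because its vertex, or one it
inevitably leads to, is occupied or lies beyond the target. -/
theorem next_two {q : C.Vertex × C.Vertex} {i : Fin C.n} {c : C.Column} {u : CrossingVertex}
    (a b : CrossingVertex) (hq : C.IsPair q.1 q.2) (h : .gadget i c u ∈ path q)
    (hu : u.transit = true := by rfl) (ha : u.next = [a, b] := by rfl) :
    .gadget i c a ∈ path q ∨ .gadget i c b ∈ path q := by
  obtain ⟨u', hu', hm, -⟩ := S.exists_next hq hu h
  rw [ha, List.mem_pair] at hu'
  rcases hu' with rfl | rfl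
  · exact .inl hm
  · exact .inr hm

/-! ### The routing gadget -/

section Routing

variable {i : Fin C.n} {c : C.Column} {b : Box} {q : C.Vertex × C.Vertex}

theorem not_external_of_mem {s t u : RoutingVertex} (h : (s, t) ∈ routingPairs)
    (hu : .gadget i c (.box b u) ∈ path (.gadget i c (.box b s), .gadget i c (.box b t)))
    (hq : External q) : .gadget i c (.box b u) ∉ path q := by
  intro hm
  have := S.eq_of_mem hq.1 (.routing i c b h) hm hu
  exact hq.2 i c b t (by rw [this])

theorem notMem_of_mem {s t s' t' : RoutingVertex} {v : C.Vertex} (h : (s, t) ∈ routingPairs)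
    (h' : (s', t') ∈ routingPairs) (hne : s ≠ s')
    (hv : v ∈ path (.gadget i c (.box b s), .gadget i c (.box b t))) :
    v ∉ path (.gadget i c (.box b s'), .gadget i c (.box b t')) := by
  intro hv'
  have := S.eq_of_mem (q := (_, _)) (q' := (_, _)) (.routing i c b h) (.routing i c b h') hv hv'
  simp only [Prod.mk.injEq, Vertex.gadget.injEq, CrossingVertex.box.injEq] at this
  exact hne (by tauto)

/-- An external path that enters a routing gadget at the top leaves it at the bottom; no external
path leaves it to the right. -/
theorem vertical (hq : External q) (h : .gadget i c b.top ∈ path q) :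
    .gadget i c b.bottomExit ∈ path q ∧
      ∀ q', External q' → .gadget i c b.right ∉ path q' := by
  have k1 : (RoutingVertex.s1, RoutingVertex.t1) ∈ routingPairs := by decide
  have k2 : (RoutingVertex.s2, RoutingVertex.t2) ∈ routingPairs := by decide
  have k3 : (RoutingVertex.s3, RoutingVertex.t3) ∈ routingPairs := by decide
  have p1 := IsPair.routing i c b k1
  have p2 := IsPair.routing i c b k2
  have p3 := IsPair.routing i c b k3
  have n12 {v} := S.notMem_of_mem (i := i) (c := c) (b := b) (v := v) k1 k2 (by decide)
  -- With `d1` occupied, the first pair must use `d3`, which pushes the second pair onto `d4` and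
  -- `d8`. The outside path is left with `d5` and `d9`, and cannot continue to `t3`, the end of the
  -- third pair.
  have a1 : .gadget i c (.box b .d3) ∈ path (.gadget i c (.box b .s1), .gadget i c (.box b .t1)) :=
    (S.next_two (.box b .d1) (.box b .d3) p1 (S.source_mem (q := (_, _)) p1) rfl
      (by cases b <;> rfl)).resolve_left fun h' => S.not_external_of_mem k1 h' hq h
  have a2 := (S.next_two (.box b .d3) (.box b .d4) p2 (S.source_mem (q := (_, _)) p2) rfl
      (by cases b <;> rfl)).resolve_left fun h' => n12 a1 h'
  have a3 := (S.next_two (.box b .t1) (.box b .d8) p2 a2 rfl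
      (by cases b <;> rfl)).resolve_left fun h' => n12 (S.target_mem (q := (_, _)) p1) h'
  have a4 := (S.next_two (.box b .d4) (.box b .d5) hq.1 h rfl
      (by cases b <;> rfl)).resolve_left fun h' => S.not_external_of_mem k2 a2 hq h'
  have a5 := (S.next_two (.box b .d8) (.box b .d9) hq.1 a4 rfl
      (by cases b <;> rfl)).resolve_left fun h' => S.not_external_of_mem k2 a3 hq h'
  have a6 := (S.next_two (.box b .t3) b.bottomExit hq.1 a5 rfl
      (by cases b <;> rfl)).resolve_left fun h' =>
        S.not_external_of_mem k3 (S.target_mem (q := (_, _)) p3) hq h'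
  exact ⟨a6, fun q' hq' => S.not_external_of_mem k2 a3 hq'⟩

/-- An external path that enters a routing gadget from the left leaves it to the right. -/
theorem horizontal (hq : External q) (h : .gadget i c b.left ∈ path q) :
    .gadget i c b.right ∈ path q ∧ .gadget i c b.rightExit ∈ path q := by
  have k2 : (RoutingVertex.s2, RoutingVertex.t2) ∈ routingPairs := by decide
  have k3 : (RoutingVertex.s3, RoutingVertex.t3) ∈ routingPairs := by decide
  have k4 : (RoutingVertex.s4, RoutingVertex.t4) ∈ routingPairs := by decide
  have p2 := IsPair.routing i c b k2
  have p3 := IsPair.routing i c b k3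
  have p4 := IsPair.routing i c b k4
  have n34 {v} := S.notMem_of_mem (i := i) (c := c) (b := b) (v := v) k3 k4 (by decide)
  -- The mirror image: `d2` is occupied, so the fourth pair takes `d7` and the third takes `d6` and
  -- `d9`.
  have a1 : .gadget i c (.box b .d7) ∈ path (.gadget i c (.box b .s4), .gadget i c (.box b .t4)) :=
    (S.next_two (.box b .d2) (.box b .d7) p4 (S.source_mem (q := (_, _)) p4) rfl
      (by cases b <;> rfl)).resolve_left fun h' => S.not_external_of_mem k4 h' hq h
  have a2 := (S.next_two (.box b .d6) (.box b .d7) p3 (S.source_mem (q := (_, _)) p3) rfl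
      (by cases b <;> rfl)).resolve_right fun h' => n34 h' a1
  have a3 := (S.next_two (.box b .d9) (.box b .t4) p3 a2 rfl
      (by cases b <;> rfl)).resolve_right fun h' => n34 h' (S.target_mem (q := (_, _)) p4)
  have a4 := (S.next_two (.box b .d5) (.box b .d6) hq.1 h rfl
      (by cases b <;> rfl)).resolve_right fun h' => S.not_external_of_mem k3 a2 hq h'
  have a5 := (S.next_two (.box b .d8) (.box b .d9) hq.1 a4 rfl
      (by cases b <;> rfl)).resolve_right fun h' => S.not_external_of_mem k3 a3 hq h'
  have a6 := (S.next_two (.box b .t2) b.rightExit hq.1 a5 rfl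
      (by cases b <;> rfl)).resolve_left fun h' =>
        S.not_external_of_mem k2 (S.target_mem (q := (_, _)) p2) hq h'
  exact ⟨a5, a6⟩

/-- A vertical passage pushes the second pair onto `d8`, the vertex through which a horizontal
passage must leave. -/
theorem not_vertical_and_horizontal {q' : C.Vertex × C.Vertex} (hq : External q)
    (h : .gadget i c b.top ∈ path q) (hq' : External q') (h' : .gadget i c b.left ∈ path q') :
    False :=
  (S.vertical hq h).2 q' hq' (S.horizontal hq' h').1

end Routing

/-! ### The crossing gadget -/

section Crossing

variable {i : Fin C.n} {c : C.Column} {w z : C.Vertex × C.Vertex}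

theorem depth_le {q : C.Vertex × C.Vertex} {u v : CrossingVertex} (hq : C.IsPair q.1 q.2)
    (ht : q.2 = .gadget i c v) (h : .gadget i c u ∈ path q) : u.depth ≤ v.depth := by
  have := S.rank_le hq h
  rw [ht] at this
  simpa [rank, Prod.Lex.toLex_le_toLex] using this

/-- A path that starts in `Z` does not leave the gadget through `B`. -/
theorem B_notMem (hz : C.IsPair z.1 z.2) (hZ : z.1 = .gadget i c .Z) :
    .gadget i c .B ∉ path z := by
  intro h
  have ht := (external_of_source_Z hz hZ).2
  have hle {v} (hv : v ∈ path z) : rank v ≤ rank z.2 := S.rank_le hz hv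
  obtain ⟨v, hv, hadj⟩ := S.exists_adj hz h (by rcases ht with ⟨c', -, ht⟩ | ⟨-, ht⟩ <;> simp [ht])
  have hr := hle hv
  -- From `B` the only edges lead to row `i + 1` or to a vertex `C_j'`; both have larger rank than
  -- any target of `Z`, which lies in row `i`.
  cases hadj with
  | inside _ _ hc => exact absurd hc.mem_next (by simp [show CrossingVertex.B.next = [] from rfl])
  | colNext _ i' _ hi =>
    rcases ht with ⟨c', -, ht⟩ | ⟨-, ht⟩ <;> simp [ht, rank, Prod.Lex.toLex_le_toLex, hi] at hr
  | colEnd _ j t hi =>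
    rcases ht with ⟨c', -, ht⟩ | ⟨-, ht⟩ <;>
      simp [ht, rank, Prod.Lex.toLex_le_toLex, ← hi] at hr

/-- If the path to `W` enters at `Hin`, the other paths are forced as follows. -/
theorem high_routing (hw : C.IsPair w.1 w.2) (hW : w.2 = .gadget i c .W)
    (hz : C.IsPair z.1 z.2) (hZ : z.1 = .gadget i c .Z) (h : .gadget i c .Hin ∈ path w) :
    .gadget i c .m3 ∈ path (crossPair i c) ∧ .gadget i c .Hout ∈ path z ∧
    ∀ q, External q → q ≠ crossPair i c → .gadget i c .T ∈ path q →
      C.columnLit c ≠ .neg i ∧ (.gadget i c .B ∈ path q ∨ .gadget i c .Lout ∈ path q) := by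
  have ew := external_of_target_W hw hW
  have ez := (external_of_source_Z hz hZ).1
  have ex := external_crossPair i c
  have nwx {v} (h : v ∈ path w) : v ∉ path (crossPair i c) := fun h' => by
    simpa [crossPair, hW] using congrArg Prod.snd (S.eq_of_mem hw ex.1 h h')
  have nzx {v} (h : v ∈ path z) : v ∉ path (crossPair i c) := fun h' => by
    simpa [crossPair, hZ] using congrArg Prod.fst (S.eq_of_mem hz ex.1 h h')
  have w1 := S.next_one (.box .b1 .d2) hw h
  have w2 := (S.horizontal ew w1).2
  have w3 := S.next_one .m4 hw w2
  -- `b4` is deeper than `W`, so a path entering it cannot come back to `W`.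
  have w4 := (S.next_two Box.b3.top Box.b4.left hw w3).resolve_right fun h' =>
    absurd (S.depth_le hw hW h') (by decide)
  have w5 := (S.vertical ew w4).1
  have x0 := S.source_mem ex.1
  have x1 := (S.next_two .m2 Box.b2.top ex.1 x0).resolve_left (nwx w2)
  have x2 := (S.vertical ex x1).1
  have x3 := S.next_one .m5 ex.1 x2
  have x4 := (S.next_two .W .m6 ex.1 x3).resolve_left (nwx w5)
  have x5 := (S.next_two .m8 .m12 ex.1 x4).resolve_right fun h' =>
    absurd (S.depth_le ex.1 rfl h') (by decide)
  have z0 := S.source_mem hz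
  rw [hZ] at z0
  -- A turn into `b5` would end in `m8`, and the later turn into `b6` would end in `Y`; both
  -- vertices lie on the path from `X`.
  have z1 := (S.next_two .m7 Box.b5.top hz z0).resolve_right fun h' =>
    nzx (S.vertical ez h').1 x5
  have z2 := S.next_one .m9 hz z1
  have z3 := (S.next_two .Hout Box.b6.top hz z2).resolve_right fun h' =>
    nzx (S.vertical ez h').1 (S.target_mem ex.1)
  refine ⟨x2, z3, fun q hq nx h => ?_⟩
  have nqx {v} (h : v ∈ path q) : v ∉ path (crossPair i c) := fun h' =>
    nx (S.eq_of_mem hq.1 ex.1 h h')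
  have q1 := S.next_one .m1 hq.1 h
  obtain ⟨u, hu, q2, hadj⟩ := S.exists_next hq.1 rfl q1
  rw [show CrossingVertex.m1.next = [Box.b4.top, Box.b1.top] from rfl, List.mem_pair] at hu
  rcases hu with rfl | rfl
  · refine ⟨?_, ?_⟩
    · cases hadj with
      | inside _ _ _ hp => exact hp rfl
    · have q3 := (S.vertical hq q2).1
      have q4 := (S.next_two .m6 Box.b5.left hq.1 q3).resolve_left fun h' => nqx h' x4
      have q5 := (S.horizontal hq q4).2
      have q6 := (S.horizontal hq q5).2
      -- The exit at `Lout` cannot be refuted inside this gadget; `clause_high` excludes it by what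
      -- comes next in the row.
      rcases S.next_two .m12 .Lout hq.1 q6 with q7 | q7
      · exact .inl (S.next_one .B hq.1 q7)
      · exact .inr q7
  · exact (S.not_vertical_and_horizontal hq q2 ew w1).elim

/-- If the path to `W` enters at `Lin`, the other paths are forced as follows. -/
theorem low_routing (hw : C.IsPair w.1 w.2) (hW : w.2 = .gadget i c .W)
    (hz : C.IsPair z.1 z.2) (hZ : z.1 = .gadget i c .Z) (h : .gadget i c .Lin ∈ path w) :
    .gadget i c .Lout ∈ path z ∧
    ∀ q, External q → q ≠ z → .gadget i c .T ∈ path q →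
      C.columnLit c ≠ .pos i ∧ .gadget i c .B ∈ path q := by
  have ew := external_of_target_W hw hW
  have ez := (external_of_source_Z hz hZ).1
  have ex := external_crossPair i c
  have nwx {v} (h : v ∈ path w) : v ∉ path (crossPair i c) := fun h' => by
    simpa [crossPair, hW] using congrArg Prod.snd (S.eq_of_mem hw ex.1 h h')
  have nzx {v} (h : v ∈ path z) : v ∉ path (crossPair i c) := fun h' => by
    simpa [crossPair, hZ] using congrArg Prod.fst (S.eq_of_mem hz ex.1 h h')
  have w1 := S.next_one .m3 hw h
  have x0 := S.source_mem ex.1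
  -- Passing down `b2` would end in `m3`, and passing down `b3` in `W`, both occupied. This forces
  -- the path from `X` across `b4` to `m7`, which in turn pushes the path from `Z` into `b5`.
  have x1 := (S.next_two .m2 Box.b2.top ex.1 x0).resolve_right fun h' =>
    nwx w1 (S.vertical ex h').1
  have x2 := S.next_one .m4 ex.1 x1
  have wW := S.target_mem hw
  rw [hW] at wW
  have x3 := (S.next_two Box.b3.top Box.b4.left ex.1 x2).resolve_left fun h' =>
    nwx wW (S.vertical ex h').1
  have x4 := (S.horizontal ex x3).2
  have z0 := S.source_mem hz
  rw [hZ] at z0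
  have z1 := (S.next_two .m7 Box.b5.top hz z0).resolve_left fun h' => nzx h' x4
  have z2 := (S.vertical ez z1).1
  have z3 := S.next_one .m10 hz z2
  have z4 := (S.next_two .Y .m11 hz z3).resolve_left fun h' => nzx h' (S.target_mem ex.1)
  have z5 := (S.next_two .m12 .Lout hz z4).resolve_left fun h' =>
    S.B_notMem hz hZ (S.next_one .B hz h')
  refine ⟨z5, fun q hq nz h => ?_⟩
  have q1 := S.next_one .m1 hq.1 h
  obtain ⟨u, hu, q2, hadj⟩ := S.exists_next hq.1 rfl q1
  rw [show CrossingVertex.m1.next = [Box.b4.top, Box.b1.top] from rfl, List.mem_pair] at hu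
  rcases hu with rfl | rfl
  · exact (S.not_vertical_and_horizontal hq q2 ex x3).elim
  · refine ⟨?_, ?_⟩
    · cases hadj with
      | inside _ _ _ _ hm => exact hm rfl
    · have q3 := (S.vertical hq q2).1
      have q4 := (S.horizontal hq q3).2
      have q5 := (S.horizontal hq q4).2
      have q6 := (S.next_two .m6 Box.b5.left hq.1 q5).resolve_right fun h' =>
        S.not_vertical_and_horizontal ez z1 hq h'
      have q7 := (S.next_two .m8 .m12 hq.1 q6).resolve_left fun h' =>
        nz (S.eq_of_mem hq.1 hz h' z2)
      exact S.next_one .B hq.1 q7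

end Crossing

/-! ### Rows -/

/-- The path to `W` enters the gadget at `Hin`. -/
def High (_ : C.IsSolution path) (i : Fin C.n) (c : C.Column) : Prop :=
  ∃ w : C.Vertex × C.Vertex, C.IsPair w.1 w.2 ∧ w.2 = .gadget i c .W ∧ .gadget i c .Hin ∈ path w

/-- The path to `W` enters the gadget at `Lin`. -/
def Low (_ : C.IsSolution path) (i : Fin C.n) (c : C.Column) : Prop :=
  ∃ w : C.Vertex × C.Vertex, C.IsPair w.1 w.2 ∧ w.2 = .gadget i c .W ∧ .gadget i c .Lin ∈ path w

section Row

variable {i : Fin C.n} {c c' : C.Column}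

theorem high_or_low_of_isMin (hc : IsMin c) : S.High i c ∨ S.Low i c := by
  have hp := IsPair.varStart i c hc
  obtain ⟨v, hv, hadj⟩ := S.exists_adj (q := (_, _)) hp (S.source_mem (q := (_, _)) hp) (by simp)
  cases hadj with
  | rowStartH _ c' hc' =>
    obtain rfl : c = c' := hc.eq_of_le (not_lt.1 (hc'.not_lt)) |>.symm
    exact .inl ⟨_, hp, rfl, hv⟩
  | rowStartL _ c' hc' =>
    obtain rfl : c = c' := hc.eq_of_le (not_lt.1 (hc'.not_lt)) |>.symm
    exact .inr ⟨_, hp, rfl, hv⟩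

/-- The path from `Z` leaves at `Hout`, whose only successor is `Hin` of the next column, and it is
the path to the next `W`. -/
theorem High.of_covBy (h : S.High i c) (hc : c ⋖ c') : S.High i c' := by
  obtain ⟨w, hw, hW, h⟩ := h
  have hp := IsPair.varNext i c c' hc
  have := (S.high_routing hw hW (z := (_, _)) hp rfl h).2.1
  obtain ⟨v, hv, hadj⟩ := S.exists_adj (q := (_, _)) hp this (by simp)
  cases hadj with
  | inside _ _ hc => exact absurd hc.mem_next (by simp [show CrossingVertex.Hout.next = [] from rfl])
  | rowNextH _ _ c'' hc' =>
    obtain rfl := hc.unique_right hc'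
    exact ⟨_, hp, rfl, hv⟩
  | rowEndH _ _ hm => exact (hm.not_lt hc.lt).elim

theorem Low.of_covBy (h : S.Low i c) (hc : c ⋖ c') : S.Low i c' := by
  obtain ⟨w, hw, hW, h⟩ := h
  have hp := IsPair.varNext i c c' hc
  have := (S.low_routing hw hW (z := (_, _)) hp rfl h).1
  obtain ⟨v, hv, hadj⟩ := S.exists_adj (q := (_, _)) hp this (by simp)
  cases hadj with
  | inside _ _ hc => exact absurd hc.mem_next (by simp [show CrossingVertex.Lout.next = [] from rfl])
  | rowNextL _ _ c'' hc' =>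
    obtain rfl := hc.unique_right hc'
    exact ⟨_, hp, rfl, hv⟩
  | rowEndL _ _ hm => exact (hm.not_lt hc.lt).elim

end Row

theorem forall_high_or_forall_low (i : Fin C.n) :
    (∀ c, S.High i c) ∨ ∀ c, S.Low i c := by
  by_cases hne : Nonempty C.Column
  · obtain ⟨c₀, -, hc₀⟩ := (wellFounded_lt (α := C.Column)).has_min Set.univ Set.univ_nonempty
    have hmin : IsMin c₀ := isMin_iff_forall_not_lt.2 fun c => hc₀ c trivial
    rcases S.high_or_low_of_isMin (i := i) hmin with h | h
    · exact .inl (column_induction hmin h fun c c' hc h => High.of_covBy S h hc)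
    · exact .inr (column_induction hmin h fun c c' hc h => Low.of_covBy S h hc)
  -- Without columns both alternatives hold vacuously; they need not exclude each other.
  · exact .inl fun c => (hne ⟨c⟩).elim

/-! ### Columns -/

/-- An exit at `Lout` would lead to `Lin` and `m3` of the next gadget, where `m3` is on the path
from `X` because that gadget is high too, or, in the last column, to `V_i'`, the end of another
path. -/
theorem clause_high {i : Fin C.n} {c : C.Column} {j : Fin C.m} (hi : ∀ c, S.High i c)
    (h : .gadget i c .T ∈ path (.clause j, .clause' j)) :
    C.columnLit c ≠ .neg i ∧ .gadget i c .B ∈ path (.clause j, .clause' j) := by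
  obtain ⟨w, hw, hW, hH⟩ := hi c
  obtain ⟨z, hz, hZ⟩ := exists_pair_of_Z i c
  have hj := external_clause j
  have ⟨h1, h2⟩ := (S.high_routing hw hW hz hZ hH).2.2 _ hj (by simp [crossPair]) h
  refine ⟨h1, h2.resolve_right fun hL => ?_⟩
  obtain ⟨v, hv, hadj⟩ := S.exists_adj hj.1 hL (by simp)
  cases hadj with
  | inside _ _ hc => exact absurd hc.mem_next (by simp [show CrossingVertex.Lout.next = [] from rfl])
  | rowNextL _ _ c' hc' =>
    obtain ⟨w', hw', hW', hH'⟩ := hi c'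
    obtain ⟨z', hz', hZ'⟩ := exists_pair_of_Z i c'
    have x := (S.high_routing hw' hW' hz' hZ' hH').1
    simpa [crossPair] using
      S.eq_of_mem hj.1 (external_crossPair i c').1 (S.next_one .m3 hj.1 hv) x
  | rowEndL _ _ hm =>
    have hp := IsPair.varEnd i c hm
    simpa using S.eq_of_mem (q' := (_, _)) hj.1 hp hv (S.target_mem (q := (_, _)) hp)

theorem clause_low {i : Fin C.n} {c : C.Column} {j : Fin C.m} (hi : ∀ c, S.Low i c)
    (h : .gadget i c .T ∈ path (.clause j, .clause' j)) :
    C.columnLit c ≠ .pos i ∧ .gadget i c .B ∈ path (.clause j, .clause' j) := by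
  obtain ⟨w, hw, hW, hL⟩ := hi c
  obtain ⟨z, hz, hZ⟩ := exists_pair_of_Z i c
  refine (S.low_routing hw hW hz hZ hL).2 _ (external_clause j) ?_ h
  rintro rfl
  simp at hZ

theorem clause_B {i : Fin C.n} {c : C.Column} {j : Fin C.m}
    (h : .gadget i c .T ∈ path (.clause j, .clause' j)) :
    .gadget i c .B ∈ path (.clause j, .clause' j) :=
  (S.forall_high_or_forall_low i).elim (fun hi => (S.clause_high hi h).2)
    fun hi => (S.clause_low hi h).2

/-- The path of a clause passes through all gadgets of one of its columns. -/
theorem exists_column (j : Fin C.m) :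
    ∃ t, ∀ i, .gadget i (toLex ⟨j, t⟩) .T ∈ path (.clause j, .clause' j) := by
  have hj := (external_clause j).1
  -- An edge leaving `C_j` exists only if the clause has a literal; this edge supplies `t`.
  obtain ⟨v, hv, hadj⟩ := S.exists_adj hj (S.source_mem hj) (by simp)
  cases hadj with
  | colStart i₀ _ t hi₀ =>
    refine ⟨t, fun ⟨k, hk⟩ => ?_⟩
    induction k with
    | zero => convert hv; exact hi₀.symm
    | succ k ih =>
      have hB := S.clause_B (ih (k.lt_succ_self.trans hk))
      obtain ⟨v, hv, hadj⟩ := S.exists_adj hj hB (by simp)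
      cases hadj with
      | inside _ _ hc =>
        exact absurd hc.mem_next (by simp [show CrossingVertex.B.next = [] from rfl])
      | colNext _ i' _ hi => convert hv; exact hi.symm
      | colEnd _ _ _ hi => simp only at hi; omega

/-- A variable is true when its row is high. A positive literal in a low row would need the deleted
`e⁻`, a negative one in a high row the deleted `e⁺`. -/
theorem satisfiable : C.Satisfiable := by
  classical
  refine ⟨fun i => decide (∀ c, S.High i c), fun j => ?_⟩
  obtain ⟨t, ht⟩ := S.exists_column j
  refine ⟨t, ?_⟩
  have hlit : C.columnLit (toLex ⟨j, t⟩) = C.lit j t := rfl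
  cases hl : C.lit j t with
  | pos i =>
    rcases S.forall_high_or_forall_low i with hi | hi
    · simpa [Literal.IsTrue] using hi
    · exact ((S.clause_low hi (ht i)).1 (hlit.trans hl)).elim
  | neg i =>
    simp only [Literal.IsTrue, decide_eq_false_iff_not]
    intro hi
    exact (S.clause_high hi (ht i)).1 (hlit.trans hl)

end IsSolution
end SATInstance
end SatVDP
namespace SatVDP

/-! ### Walks through prescribed vertices -/

/-- There is a walk from `s` to `t` whose vertices satisfy `P`. -/
def Linked {V : Type} (G : Digraph V) (P : V → Prop) (s t : V) : Prop :=
  ∃ p : List V, p.head? = some s ∧ p.getLast? = some t ∧ p.IsChain G.Adj ∧ ∀ v ∈ p, P v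

section Linked

variable {V : Type} {G : Digraph V} {P : V → Prop} {s t u v : V}

theorem Linked.refl (h : P s) : Linked G P s s := ⟨[s], by simp [h]⟩

theorem Linked.append (h₁ : Linked G P s t) (h : G.Adj t u) (h₂ : Linked G P u v) :
    Linked G P s v := by
  obtain ⟨p, ps, pt, pc, pP⟩ := h₁
  obtain ⟨p', pu, pv, pc', pP'⟩ := h₂
  refine ⟨p ++ p', by simp [ps], by simp [pv], ?_, ?_⟩
  · refine List.isChain_append.2 ⟨pc, pc', fun x hx y hy => ?_⟩
    rw [pt] at hx
    rw [pu] at hy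
    cases hx
    cases hy
    exact h
  · intro x hx
    exact (List.mem_append.1 hx).elim (pP x) (pP' x)

/-- The rank increases strictly along a walk, so no vertex is repeated. -/
theorem Linked.exists_isDirectedPath {R : Type} [Preorder R] {r : V → R}
    (hr : ∀ u v, G.Adj u v → r u < r v) (h : Linked G P s t) :
    ∃ p, IsDirectedPath G s t p ∧ ∀ v ∈ p, P v := by
  obtain ⟨p, ps, pt, pc, pP⟩ := h
  refine ⟨p, ⟨ps, pt, pc, ?_⟩, pP⟩
  have : (p.map r).IsChain (· < ·) := (List.isChain_map r).2 (pc.imp fun u v => hr u v)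
  exact List.Nodup.of_map r (List.isChain_iff_pairwise.1 this).nodup

end Linked

/-! ### The paths through the gadgets -/

/-- The path of the pair with target `t` in a routing gadget that is passed from top to bottom
(`vert = true`) or from left to right (`vert = false`). -/
def routingPath (vert : Bool) : RoutingVertex → List RoutingVertex
  | .t1 => if vert then [.s1, .d3, .t1] else [.s1, .d1, .d4, .t1]
  | .t2 => if vert then [.s2, .d4, .d8, .t2] else [.s2, .d3, .t2]
  | .t3 => if vert then [.s3, .d7, .t3] else [.s3, .d6, .d9, .t3]
  | .t4 => if vert then [.s4, .d2, .d6, .t4] else [.s4, .d7, .t4]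
  | _ => []

/-- The target of the path on which a vertex of a routing gadget lies, if it is one of the paths
of the routing gadget. -/
def routingOwner (vert : Bool) : RoutingVertex → Option RoutingVertex
  | .s1 | .t1 => some .t1
  | .s2 | .t2 => some .t2
  | .s3 | .t3 => some .t3
  | .s4 | .t4 => some .t4
  | .d1 => if vert then none else some .t1
  | .d2 => if vert then some .t4 else none
  | .d3 => if vert then some .t1 else some .t2
  | .d4 => if vert then some .t2 else some .t1
  | .d5 => none
  | .d6 => if vert then some .t4 else some .t3
  | .d7 => if vert then some .t3 else some .t4
  | .d8 => if vert then some .t2 else none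
  | .d9 => if vert then none else some .t3

theorem routingPath_spec : ∀ vert : Bool, ∀ e ∈ routingPairs,
    (routingPath vert e.2).head? = some e.1 ∧ (routingPath vert e.2).getLast? = some e.2 ∧
    (routingPath vert e.2).IsChain (fun u v => (u, v) ∈ routingEdges) ∧
    ∀ v ∈ routingPath vert e.2, routingOwner vert v = some e.2 := by
  decide

/-- The kinds of paths that visit a crossing gadget: the one to `W`, the one to `Y`, the one
from `Z`, that of the clause, and those of the routing gadgets, given by their targets. -/
inductive Owner where
  | toW | toY | fromZ | clause
  | routing (b : Box) (t : RoutingVertex)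
  deriving DecidableEq

/-- The direction in which the routing gadgets are passed if the path to `W` enters at `Hin`
(`h = true`) or at `Lin` (`h = false`). -/
def Box.isVertical (h : Bool) : Box → Bool
  | b2 | b3 | b4 => h
  | b1 | b5 | b6 => !h

/-- The path that passes through a routing gadget. -/
def Box.owner (h : Bool) : Box → Owner
  | b1 => if h then .toW else .clause
  | b2 => if h then .toY else .clause
  | b3 => if h then .toW else .clause
  | b4 => if h then .clause else .toY
  | b5 => if h then .clause else .fromZ
  | b6 => if h then .clause else .toY

/-- The path on which a vertex of the crossing gadget lies. -/
def CrossingVertex.owner (h : Bool) : CrossingVertex → Owner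
  | Hin | Lin | W => .toW
  | Hout | Lout | Z => .fromZ
  | T | B | m1 | m12 => .clause
  | X | Y => .toY
  | m0 => .clause
  | m2 => if h then .toW else .toY
  | m3 => if h then .toY else .toW
  | m4 => if h then .toW else .toY
  | m5 => if h then .toY else .toW
  | m6 => if h then .toY else .clause
  | m7 => if h then .fromZ else .toY
  | m8 => if h then .toY else .fromZ
  | m9 => if h then .fromZ else .toY
  | m10 => if h then .toY else .fromZ
  | m11 => if h then .clause else .fromZ
  -- Whatever the gadget's own four paths leave free goes to the path passing through it.
  | box b v => ((routingOwner (b.isVertical h) v).map (Owner.routing b)).getD (b.owner h)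

/-- Through a routing gadget from top to bottom. -/
def Box.down (b : Box) : List CrossingVertex := [b.top, .box b .d5, b.bottom]

/-- Through a routing gadget from left to right. -/
def Box.across (b : Box) : List CrossingVertex := [b.left, .box b .d5, b.right]

open CrossingVertex Box

/-- The part of the path to `W` in the crossing gadget. -/
def pathToW (h : Bool) : List CrossingVertex :=
  if h then Hin :: b1.across ++ m2 :: m4 :: b3.down ++ [W] else [Lin, m3, m5, W]

/-- The path to `Y`. -/
def pathToY (h : Bool) : List CrossingVertex :=
  if h then X :: b2.down ++ [m3, m5, m6, m8, m10, Y]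
  else X :: m2 :: m4 :: b4.across ++ m7 :: m9 :: b6.down ++ [Y]

/-- The part of the path from `Z` in the crossing gadget. -/
def pathFromZ (h : Bool) : List CrossingVertex :=
  if h then [Z, m7, m9, Hout] else Z :: b5.down ++ [m8, m10, m11, Lout]

/-- The part of the path of the clause in the crossing gadget after `m1`. -/
def pathClause (h : Bool) : List CrossingVertex :=
  if h then b4.down ++ m0 :: b5.across ++ b6.across ++ [m11, m12, B]
  else b1.down ++ b2.across ++ b3.across ++ [m0, m6, m12, B]

/-- The edges of the crossing gadget that are never deleted. -/
def InnerStep (u v : CrossingVertex) : Prop := v ∈ u.next ∧ u ≠ m1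

instance : DecidableRel InnerStep := fun u v => inferInstanceAs (Decidable (v ∈ u.next ∧ u ≠ m1))

/-- A finite check for both truth values, as are the next three; the last conjunct is what yields
disjointness. -/
theorem pathToW_spec : ∀ h : Bool, (pathToW h).head? = some (if h then Hin else Lin) ∧
    (pathToW h).getLast? = some W ∧ (pathToW h).IsChain InnerStep ∧
    ∀ v ∈ pathToW h, v.owner h = .toW := by
  decide

theorem pathToY_spec : ∀ h : Bool, (pathToY h).head? = some X ∧
    (pathToY h).getLast? = some Y ∧ (pathToY h).IsChain InnerStep ∧
    ∀ v ∈ pathToY h, v.owner h = .toY := by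
  decide

theorem pathFromZ_spec : ∀ h : Bool, (pathFromZ h).head? = some Z ∧
    (pathFromZ h).getLast? = some (if h then Hout else Lout) ∧ (pathFromZ h).IsChain InnerStep ∧
    ∀ v ∈ pathFromZ h, v.owner h = .fromZ := by
  decide

theorem pathClause_spec : ∀ h : Bool,
    (pathClause h).head? = some (if h then b4.top else b1.top) ∧
    (pathClause h).getLast? = some B ∧ (pathClause h).IsChain InnerStep ∧
    ∀ v ∈ pathClause h, v.owner h = .clause := by
  decide

theorem CrossingAdj.of_mem_next {u v : CrossingVertex} (h : v ∈ u.next) : CrossingAdj u v := by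
  have outer : v ∈ u.outerNext → CrossingAdj u v := by
    simp only [outerNext, List.mem_map, List.mem_filter, List.mem_cons, decide_eq_true_eq]
    rintro ⟨e, ⟨rfl | rfl | he, rfl⟩, rfl⟩
    · exact .plus
    · exact .minus
    · exact .outer he
  cases u with
  | box b u =>
    rcases List.mem_append.1 h with h | h
    · simp only [RoutingVertex.next, List.mem_map, List.mem_filter, decide_eq_true_eq] at h
      obtain ⟨v, ⟨e, ⟨he, rfl⟩, rfl⟩, rfl⟩ := h
      exact .inner b he
    · exact outer h
  | _ => exact outer h

namespace SATInstance

variable {C : SATInstance}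

theorem InnerStep.adj {u v : CrossingVertex} (h : InnerStep u v) (i : Fin C.n) (c : C.Column) :
    C.Adj (.gadget i c u) (.gadget i c v) :=
  .inside i c (.of_mem_next h.1) (fun he => (h.2 (congrArg Prod.fst he)).elim)
    fun he => (h.2 (congrArg Prod.fst he)).elim

/-- Makes it sufficient to separate the constructed paths by their targets. -/
theorem IsPair.source_unique {s s' t : C.Vertex} (h : C.IsPair s t) (h' : C.IsPair s' t) :
    s = s' := by
  cases h with
  | @routing i c b u v h =>
    cases h' with
    | @routing _ _ _ u' _ h' =>
      have : ∀ e ∈ routingPairs, ∀ e' ∈ routingPairs, e.2 = e'.2 → e.1 = e'.1 := by decide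
      have := this _ h _ h' rfl
      simp only at this
      rw [this]
  | varStart i c hc =>
    cases h' with
    | varStart => rfl
    | varNext _ c' _ hc' => exact (hc.not_lt hc'.lt).elim
  | varNext i c c' hc =>
    cases h' with
    | varStart _ _ hc' => exact (hc'.not_lt hc.lt).elim
    | varNext _ c'' _ hc' => rw [hc.unique_left hc']
  | varEnd i c hc =>
    cases h' with
    | varEnd _ c' hc' => rw [hc.eq_of_ge (not_lt.1 hc'.not_lt)]
  | cross => cases h'; rfl
  | clausePair => cases h'; rfl

/-! ### The solution of an assignment -/

open Classical in
/-- The target of the source `V_i`. -/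
noncomputable def varTarget (i : Fin C.n) : C.Vertex :=
  -- The default arises only when there are no columns, and then `V_i` is not a source.
  if h : ∃ c : C.Column, IsMin c then .gadget i h.choose .W else .var i

open Classical in
/-- The target of the source `Z` in row `i` and column `c`. -/
noncomputable def nextTarget (i : Fin C.n) (c : C.Column) : C.Vertex :=
  if h : ∃ c', c ⋖ c' then .gadget i h.choose .W else .var' i

theorem varTarget_eq (i : Fin C.n) {c : C.Column} (hc : IsMin c) :
    varTarget i = .gadget i c .W := by
  have h : ∃ c : C.Column, IsMin c := ⟨c, hc⟩
  rw [varTarget, dif_pos h, h.choose_spec.eq_of_le (not_lt.1 hc.not_lt)]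

theorem nextTarget_eq (i : Fin C.n) {c c' : C.Column} (hc : c ⋖ c') :
    nextTarget i c = .gadget i c' .W := by
  have h : ∃ c', c ⋖ c' := ⟨c', hc⟩
  rw [nextTarget, dif_pos h, h.choose_spec.unique_right hc]

theorem nextTarget_eq_var' (i : Fin C.n) {c : C.Column} (hc : IsMax c) :
    nextTarget i c = .var' i :=
  dif_neg fun ⟨_, h⟩ => hc.not_lt h.lt

/-- The target of the path on which a vertex lies in the solution of the assignment `β`. -/
noncomputable def targetOf (β : Fin C.n → Bool) : C.Vertex → C.Vertex
  | .var i => varTarget i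
  | .var' i => .var' i
  | .clause j => .clause' j
  | .clause' j => .clause' j
  | .gadget i c v =>
    match v.owner (β i) with
    | .toW => .gadget i c .W
    | .toY => .gadget i c .Y
    | .fromZ => nextTarget i c
    -- All columns of a clause carry its label, although its path uses only one of them.
    | .clause => .clause' (ofLex c).1
    | .routing b t => .gadget i c (.box b t)

section Construction

variable (β : Fin C.n → Bool)

/-- The vertices `s` and `t` are linked by a walk that is assigned to the target `τ`. -/
abbrev LinkedTo (τ s t : C.Vertex) : Prop := Linked C.graph (fun v => targetOf β v = τ) s t

variable {β}

theorem linkedTo_gadget (i : Fin C.n) (c : C.Column) {p : List CrossingVertex}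
    {u v : CrossingVertex} {τ : C.Vertex}
    (h : p.head? = some u ∧ p.getLast? = some v ∧ p.IsChain InnerStep ∧
      ∀ v ∈ p, targetOf β (.gadget i c v) = τ) :
    LinkedTo β τ (.gadget i c u) (.gadget i c v) := by
  obtain ⟨hu, hv, hc, hτ⟩ := h
  refine ⟨p.map (.gadget i c), by simp [hu], by simp [hv], ?_, by simpa using hτ⟩
  exact (List.isChain_map _).2 (hc.imp fun u v h => InnerStep.adj h i c)

theorem linkedTo_W (i : Fin C.n) (c : C.Column) :
    LinkedTo β (.gadget i c .W) (.gadget i c (if β i then .Hin else .Lin)) (.gadget i c .W) :=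
  have ⟨h₁, h₂, h₃, h₄⟩ := pathToW_spec (β i)
  linkedTo_gadget i c ⟨h₁, h₂, h₃, fun v hv => by simp only [targetOf, h₄ v hv]⟩

theorem linkedTo_Y (i : Fin C.n) (c : C.Column) :
    LinkedTo β (.gadget i c .Y) (.gadget i c .X) (.gadget i c .Y) :=
  have ⟨h₁, h₂, h₃, h₄⟩ := pathToY_spec (β i)
  linkedTo_gadget i c ⟨h₁, h₂, h₃, fun v hv => by simp only [targetOf, h₄ v hv]⟩

theorem linkedTo_nextTarget (i : Fin C.n) (c : C.Column) :
    LinkedTo β (nextTarget i c) (.gadget i c .Z) (.gadget i c (if β i then .Hout else .Lout)) :=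
  have ⟨h₁, h₂, h₃, h₄⟩ := pathFromZ_spec (β i)
  linkedTo_gadget i c ⟨h₁, h₂, h₃, fun v hv => by simp only [targetOf, h₄ v hv]⟩

theorem linkedTo_routing (i : Fin C.n) (c : C.Column) (b : Box) {s t : RoutingVertex}
    (h : (s, t) ∈ routingPairs) :
    LinkedTo β (.gadget i c (.box b t)) (.gadget i c (.box b s)) (.gadget i c (.box b t)) := by
  obtain ⟨h₁, h₂, h₃, h₄⟩ := routingPath_spec (b.isVertical (β i)) _ h
  simp only at h₁ h₂ h₃ h₄
  refine linkedTo_gadget i c (p := (routingPath (b.isVertical (β i)) t).map (.box b))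
    ⟨by simp [h₁], by simp [h₂], (List.isChain_map _).2 (h₃.imp fun u v h => ?_), ?_⟩
  · exact ⟨(CrossingAdj.inner b h).mem_next, by simp⟩
  · intro v hv
    obtain ⟨v, hv', rfl⟩ := List.mem_map.1 hv
    simp [targetOf, CrossingVertex.owner, h₄ v hv']

/-- The path of a clause can pass through a gadget in the column of a true literal. -/
theorem linkedTo_clause (i : Fin C.n) (c : C.Column) (h : (C.columnLit c).IsTrue β) :
    LinkedTo β (.clause' (ofLex c).1) (.gadget i c .T) (.gadget i c .B) := by
  have ⟨h₁, h₂, h₃, h₄⟩ := pathClause_spec (β i)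
  have hT : LinkedTo β (.clause' (ofLex c).1) (.gadget i c .T) (.gadget i c .m1) :=
    linkedTo_gadget i c (p := [T, m1]) ⟨rfl, rfl, by decide, by simp [targetOf, CrossingVertex.owner]⟩
  refine hT.append ?_
    (linkedTo_gadget i c ⟨h₁, h₂, h₃, fun v hv => by simp only [targetOf, h₄ v hv]⟩)
  -- The edge needed out of `m1` is deleted only if the column's literal is false under `β`.
  have hne : C.columnLit c ≠ if β i then .neg i else .pos i := by
    intro he
    rw [he] at h
    cases hi : β i <;> simp [hi, Literal.IsTrue] at h
  cases hi : β i
  · rw [hi] at hne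
    exact .inside i c .minus (by simp [ePlus]) fun _ => hne
  · rw [hi] at hne
    exact .inside i c .plus (fun _ => hne) (by simp [eMinus])

theorem linkedTo_pair (hβ : ∀ j, ∃ t, (C.lit j t).IsTrue β) {s t : C.Vertex} (h : C.IsPair s t) :
    LinkedTo β t s t := by
  cases h with
  | routing i c b h => exact linkedTo_routing i c b h
  | varStart i c hc =>
    have h : LinkedTo β (.gadget i c .W) (.var i) (.var i) := Linked.refl (varTarget_eq i hc)
    refine h.append ?_ (linkedTo_W i c)
    cases β i
    · exact .rowStartL i c hc
    · exact .rowStartH i c hc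
  | varNext i c c' hc =>
    rw [← nextTarget_eq i hc]
    refine (linkedTo_nextTarget i c).append ?_ (nextTarget_eq i hc ▸ linkedTo_W i c')
    cases β i
    · exact .rowNextL i c c' hc
    · exact .rowNextH i c c' hc
  | varEnd i c hc =>
    have h := linkedTo_nextTarget (β := β) i c
    rw [nextTarget_eq_var' i hc] at h
    refine h.append ?_ (Linked.refl rfl)
    cases β i
    · exact .rowEndL i c hc
    · exact .rowEndH i c hc
  | cross i c => exact linkedTo_Y i c
  | clausePair j =>
    obtain ⟨t, ht⟩ := hβ j
    have hj : LinkedTo β (.clause' j) (.clause j) (.clause j) := Linked.refl rfl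
    have hrow (i : Fin C.n) := linkedTo_clause i (toLex ⟨j, t⟩) ht
    have hB : ∀ k (hk : k < C.n),
        LinkedTo β (.clause' j) (.clause j) (.gadget ⟨k, hk⟩ (toLex ⟨j, t⟩) .B) := by
      intro k
      induction k with
      | zero => exact fun hk => hj.append (Adj.colStart ⟨0, hk⟩ j t rfl) (hrow ⟨0, hk⟩)
      | succ k ih =>
        exact fun hk => (ih (k.lt_succ_self.trans hk)).append (Adj.colNext _ _ _ rfl) (hrow ⟨_, hk⟩)
    -- A literal involves some variable, so there is a last row `C.n - 1`.
    have hn : 0 < C.n := by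
      cases C.lit j t with
      | pos i => exact i.pos
      | neg i => exact i.pos
    exact (hB (C.n - 1) (by omega)).append (Adj.colEnd _ j t (by simp only; omega)) (Linked.refl rfl)

theorem hasSolution_of_satisfiable (h : C.Satisfiable) : C.vdp.HasSolution := by
  obtain ⟨β, hβ⟩ := h
  have (q : C.Vertex × C.Vertex) : ∃ p, C.IsPair q.1 q.2 →
      IsDirectedPath C.graph q.1 q.2 p ∧ ∀ v ∈ p, targetOf β v = q.2 := by
    by_cases hq : C.IsPair q.1 q.2
    · obtain ⟨p, hp⟩ := (linkedTo_pair hβ hq).exists_isDirectedPath rank_lt_of_adj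
      exact ⟨p, fun _ => hp⟩
    · exact ⟨[], fun h => (hq h).elim⟩
  choose path hpath using this
  refine ⟨path, fun q hq => (hpath q hq).1, fun q hq q' hq' hne v hv hv' => hne ?_⟩
  have ht : q.2 = q'.2 := ((hpath q hq).2 v hv).symm.trans ((hpath q' hq').2 v hv')
  have hq₁ : C.IsPair q.1 q.2 := hq
  rw [ht] at hq₁
  exact Prod.ext (hq₁.source_unique hq') ht

end Construction
end SATInstance
end SatVDP

/-- A SAT instance is satisfiable if and only if the vertex disjoint paths instance built from it
has a solution. -/
theorem theorem2 (C : SatVDP.SATInstance) : C.Satisfiable ↔ C.vdp.HasSolution := by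
  refine ⟨SatVDP.SATInstance.hasSolution_of_satisfiable, ?_⟩
  rintro ⟨path, h₁, h₂⟩
  exact SatVDP.SATInstance.IsSolution.satisfiable (path := path) ⟨h₁, h₂⟩
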